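/- Let $k$ be an algebraically closed field of characteristic zero. A fusion category over $k$ is a $k$-linear abelian semisimple rigid monoidal category with bilinear tensor product, finite-dimensional morphism spaces, finitely many simple objects up to isomorphism, and simple unit object $\mathbf 1$. For a fusion category $\mathcal C$ let $\mathrm{Irr}(\mathcal C)$ be the set of isomorphism classes of simple objects; for $X\in\mathrm{Irr}(\mathcal C)$ let $\mathrm{FPdim}(X)$ be the largest nonnegative real eigenvalue of the matrix of left multiplication by $[X]$ in the basis $\mathrm{Irr}(\mathcal C)$ of the Grothendieck ring. Let $G(\mathcal C)$ be the group of isomorphism classes of invertible objects (simple $X$ with $X\otimes X^*\cong\mathbf 1$), let $\mathcal C_{ad}$ be the smallest fusion subcategory containing all simple constituents of $X\otimes X^*$ for all simple $X$, and let $\mathcal U(\mathcal C)$ be the universal grading group, i.e. the group generated by $\mathrm{Irr}(\mathcal C)$ with relations $[X][Y]=[Z]$ whenever $Z$ is a simple constituent of $X\otimes Y$. A Yang–Lee category is a fusion category with exactly two simple objects $\mathbf 1, X$ up to isomorphism, such that $X\otimes X\cong\mathbf 1\oplus X$. Let $G$ be a group and let $\mathcal C=\bigoplus_{g\in G}\mathcal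 C_g$ be a fusion category over $k$ with a faithful $G$-grading (that is, $\mathcal C_g\otimes\mathcal C_h\subseteq\mathcal C_{gh}$ and $\mathcal C_g\neq 0$ for all $g,h\in G$) whose trivial component $\mathcal C_e$ is identified, by a $k$-linear monoidal equivalence, with a Yang–Lee category $\mathcal Y$. Put $n=|G(\mathcal C)|$. Then: (1) $\mathcal C$ is of type $(1,n;\frac{1+\sqrt5}{2},n)$: every simple object has Frobenius–Perron dimension $1$ or $\frac{1+\sqrt5}{2}$, and up to isomorphism there are exactly $n$ simple objects of each of these two dimensions. (2) For every $g\in G$ the component $\mathcal C_g$ has exactly two simple objects $\delta_g,Y_g$ up to isomorphism; $\delta_g$ is invertible, $\mathrm{FPdim}(\delta_g)=1$ and $\mathrm{FPdim}(Y_g)=\frac{1+\sqrt5}{2}$. (3) $\mathcal Y=\mathcal C_{ad}$ (as subcategories of $\mathcal C$); $G=\mathcal U(\mathcal C)$, that is, there is a group isomorphism $\varphi:\mathcal U(\mathcal C)\to G$ such that a simple object $X$ lies in $\mathcal C_g$ if and only if $\varphi([X])=g$; and $|\mathcal U(\mathcal C)|=n$. -/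

import Mathlib

open CategoryTheory CategoryTheory.Limits MonoidalCategory

namespace Fusion

universe w v u

attribute [local instance] Abelian.hasFiniteBiproducts

/-- A fusion category over `k`: the typeclass arguments say that `C` is a `k`-linear abelian rigid
monoidal category with bilinear tensor product; the fields say that it is semisimple with
finite-dimensional morphism spaces, finitely many simple objects up to isomorphism, and simple
unit. -/
class IsFusionCategory (k : Type w) [Field k] (C : Type u) [Category.{v} C] [Abelian C]
    [Linear k C] [MonoidalCategory C] [MonoidalPreadditive C] [MonoidalLinear k C]
    [RigidCategory C] : Prop where
  finiteDimensional_hom : ∀ X Y : C, FiniteDimensional k (X ⟶ Y)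
  semisimple : ∀ X : C, ∃ (m : ℕ) (S : Fin m → C), (∀ i, Simple (S i)) ∧ Nonempty (X ≅ ⨁ S)
  finite_simples : ∃ (m : ℕ) (S : Fin m → C), ∀ X : C, Simple X → ∃ i, Nonempty (X ≅ S i)
  simple_unit : Simple (𝟙_ C)

section Irr

variable (C : Type u) [Category.{v} C] [HasZeroMorphisms C]

/-- Isomorphism of simple objects. -/
def simpleSetoid : Setoid {X : C // Simple X} where
  r X Y := Nonempty (X.1 ≅ Y.1)
  iseqv :=
    { refl := fun X => ⟨Iso.refl X.1⟩
      symm := fun ⟨e⟩ => ⟨e.symm⟩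
      trans := fun ⟨e⟩ ⟨f⟩ => ⟨e.trans f⟩ }

/-- `Irr(C)`: the set of isomorphism classes of simple objects. -/
def Irr : Type u := Quotient (simpleSetoid C)

variable {C}

/-- A representative of an isomorphism class of simple objects. -/
noncomputable def Irr.obj (x : Irr C) : C := (Quotient.out (s := simpleSetoid C) x).1

/-- `S` is a simple constituent of `X`: a simple object which is a subobject of `X`. -/
def IsSimpleConstituent (S X : C) : Prop := Simple S ∧ ∃ f : S ⟶ X, Mono f

end Irr

theorem finite_irr (k : Type w) [Field k] (C : Type u) [Category.{v} C] [Abelian C]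
    [Linear k C] [MonoidalCategory C] [MonoidalPreadditive C] [MonoidalLinear k C]
    [RigidCategory C] [h : IsFusionCategory k C] : Finite (Irr C) := by
  obtain ⟨m, S, hS⟩ := h.finite_simples
  choose i hi using fun x : Irr C => hS x.obj (Quotient.out (s := simpleSetoid C) x).2
  refine Finite.of_injective i fun x y hxy => ?_
  obtain ⟨e⟩ := hi x
  obtain ⟨f⟩ := hi y
  rw [← hxy] at f
  exact Quotient.out_equiv_out.1 ⟨e.trans f.symm⟩

section FPdim

variable (k : Type w) [Field k] {C : Type u} [Category.{v} C] [Abelian C] [Linear k C]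
  [MonoidalCategory C]

/-- The matrix of left multiplication by the class `x` in the basis `Irr(C)` of the Grothendieck
ring: the entry in row `z` and column `y` is the multiplicity of `z` in `x ⊗ y`. -/
noncomputable def leftMulMatrix (x : Irr C) : Matrix (Irr C) (Irr C) ℝ :=
  fun z y => (Module.finrank k (z.obj ⟶ x.obj ⊗ y.obj) : ℝ)

/-- The Frobenius–Perron dimension of a simple object: the largest nonnegative real eigenvalue of
the matrix of left multiplication by its class. -/
noncomputable def FPdim [MonoidalPreadditive C] [MonoidalLinear k C] [RigidCategory C]
    [IsFusionCategory k C] (x : Irr C) : ℝ :=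
  haveI := finite_irr k C
  letI := Fintype.ofFinite (Irr C)
  sSup {r : ℝ | 0 ≤ r ∧ ∃ v : Irr C → ℝ, v ≠ 0 ∧ (leftMulMatrix k x).mulVec v = r • v}

/-- `C` is of type `(d 0, n 0; …; d s, n s)`, where `1 = d 0 < ⋯ < d s` and the `n i` are positive:
the Frobenius–Perron dimensions of the simple objects are the numbers `d i`, and there are exactly
`n i` isomorphism classes of simple objects of dimension `d i`. -/
structure IsOfType (C : Type u) [Category.{v} C] [Abelian C] [Linear k C]
    [MonoidalCategory C] [MonoidalPreadditive C] [MonoidalLinear k C] [RigidCategory C]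
    [IsFusionCategory k C] {s : ℕ} (d : Fin (s + 1) → ℝ) (n : Fin (s + 1) → ℕ) : Prop where
  dim_zero : d 0 = 1
  dim_strictMono : StrictMono d
  mult_pos : ∀ i, 0 < n i
  card_eq : ∀ i, Nat.card {x : Irr C // FPdim k x = d i} = n i
  exhaust : ∀ x : Irr C, ∃ i, FPdim k x = d i

/-- A Yang–Lee category: a fusion category with exactly two simple objects `𝟙`, `X` up to
isomorphism, such that `X ⊗ X ≅ 𝟙 ⊕ X`. -/
def IsYangLee (C : Type u) [Category.{v} C] [Abelian C] [Linear k C]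
    [MonoidalCategory C] [MonoidalPreadditive C] [MonoidalLinear k C] [RigidCategory C] : Prop :=
  IsFusionCategory k C ∧ ∃ X : C, Simple X ∧ IsEmpty (X ≅ 𝟙_ C) ∧
    (∀ S : C, Simple S → Nonempty (S ≅ 𝟙_ C) ∨ Nonempty (S ≅ X)) ∧
    Nonempty (X ⊗ X ≅ 𝟙_ C ⊞ X)

end FPdim

section Subcategories

variable (C : Type u) [Category.{v} C] [Abelian C] [MonoidalCategory C]

/-- The set underlying the group `G(C)` of isomorphism classes of invertible objects: the classes of
those simple objects `X` for which `X ⊗ X* ≅ 𝟙`. -/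
def invertibles [RigidCategory C] : Set (Irr C) :=
  {x | Nonempty (x.obj ⊗ HasRightDual.rightDual x.obj ≅ 𝟙_ C)}

variable {C}

/-- Fusion subcategories, as full replete subcategories: closed under tensor products, duals,
finite direct sums and direct summands, and containing the unit. -/
structure IsFusionSubcategory [RigidCategory C] (P : ObjectProperty C) : Prop where
  iso : ∀ {X Y : C}, (X ≅ Y) → P X → P Y
  unit : P (𝟙_ C)
  tensor : ∀ {X Y : C}, P X → P Y → P (X ⊗ Y)
  rightDual : ∀ {X : C}, P X → P (HasRightDual.rightDual X)
  leftDual : ∀ {X : C}, P X → P (HasLeftDual.leftDual X)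
  zero : ∀ {X : C}, IsZero X → P X
  biprod : ∀ {X Y : C}, P X → P Y → P (X ⊞ Y)
  summand : ∀ {X Y : C}, P (X ⊞ Y) → P X

variable (C) in
/-- The adjoint subcategory `C_ad`: the smallest fusion subcategory containing all simple
constituents of `X ⊗ X*`, for all simple `X`. -/
def adjointSubcategory [RigidCategory C] : ObjectProperty C := fun Z =>
  ∀ P : ObjectProperty C, IsFusionSubcategory P →
    (∀ X S : C, Simple X → IsSimpleConstituent S (X ⊗ HasRightDual.rightDual X) → P S) → P Z

/-- A grading `C = ⊕_{g ∈ G} C_g` by a group `G`: full replete subcategories `C_g` with no nonzero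
morphisms between different ones, such that each object is a finite direct sum of homogeneous
objects and `⊗` maps `C_g × C_h` to `C_{gh}`. (Closure of each `C_g` under direct sums and summands
follows from these conditions.) -/
structure Grading (C : Type u) [Category.{v} C] [Abelian C] [MonoidalCategory C]
    (G : Type w) [Group G] where
  component : G → ObjectProperty C
  iso : ∀ {g : G} {X Y : C}, (X ≅ Y) → component g X → component g Y
  zero : ∀ (g : G) {X : C}, IsZero X → component g X
  hom_eq_zero : ∀ {g h : G} {X Y : C}, g ≠ h → component g X → component h Y →
    ∀ f : X ⟶ Y, f = 0
  decomposition : ∀ X : C, ∃ (s : Finset G) (Z : s → C),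
    (∀ g : s, component g.1 (Z g)) ∧ Nonempty (X ≅ ⨁ Z)
  tensor : ∀ {g h : G} {X Y : C}, component g X → component h Y → component (g * h) (X ⊗ Y)

/-- A grading is faithful if all its components are nonzero. -/
def Grading.IsFaithful {G : Type w} [Group G] (𝒢 : Grading C G) : Prop :=
  ∀ g : G, ∃ X : C, 𝒢.component g X ∧ ¬ IsZero X

/-- `Irr(C_g)`: the classes of simple objects lying in the component of degree `g`. -/
def Grading.irr {G : Type w} [Group G] (𝒢 : Grading C G) (g : G) : Set (Irr C) :=
  {x | 𝒢.component g x.obj}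

variable (C)

/-- The universal grading group `U(C)`: generated by the classes of simple objects, with a relation
`[x] [y] = [z]` for every simple constituent `z` of `x ⊗ y`. It is the universal target of
gradings of `C`. -/
def UniversalGradingGroup : Type u :=
  PresentedGroup {r : FreeGroup (Irr C) | ∃ x y z : Irr C,
    IsSimpleConstituent z.obj (x.obj ⊗ y.obj) ∧
      r = FreeGroup.of x * FreeGroup.of y * (FreeGroup.of z)⁻¹}

instance : Group (UniversalGradingGroup C) :=
  inferInstanceAs (Group (PresentedGroup _))

variable {C}

/-- The degree of a simple object in the universal grading. -/
def universalDegree (x : Irr C) : UniversalGradingGroup C :=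
  PresentedGroup.of x

end Subcategories

end Fusion

/-!
Let `T` be the nontrivial simple object of `C_e`, so `T ⊗ T ≅ 𝟙 ⊕ T`. For a simple object `X`,
either `T ⊗ X` is simple, or `X ≅ T ⊗ R` with `R` and `T ⊗ R` simple and then `T ⊗ X ≅ R ⊕ X`. The
simple constituents of `X ⊗ X*` lie in `C_e`, hence are `𝟙` and copies of `T`; therefore `T ⊗ X` is
simple exactly when `X` is invertible, and each `C_g` has the simple objects `D` and `T ⊗ D` for one
invertible `D`. The function equal to `1` on invertible and to the golden ratio on the other simple
objects is a positive character of the Grothendieck ring, so it is `FPdim`. Since `𝟙` and `T` are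
constituents of their own squares, they have trivial universal degree; as every element of `U(C)` is
the degree of a simple object, the map `U(C) → G` is injective.
-/

namespace Fusion

attribute [local instance] Abelian.hasFiniteBiproducts

section HomDim

variable (k : Type*) [Field k] {C : Type*} [Category* C] [Preadditive C] [Linear k C]

/-- The dimension of the space of morphisms from `A` to `B`. In a fusion category over an
algebraically closed field this is the multiplicity of `A` in `B` if `A` is simple. -/
noncomputable def homDim (A B : C) : ℕ := Module.finrank k (A ⟶ B)

theorem homDim_congr {A A' B B' : C} (e : A ≅ A') (f : B ≅ B') : homDim k A B = homDim k A' B' :=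
  (Linear.homCongr k e f).finrank_eq

theorem homDim_congr_left {A A' : C} (e : A ≅ A') (B : C) : homDim k A B = homDim k A' B :=
  homDim_congr k e (Iso.refl B)

theorem homDim_congr_right (A : C) {B B' : C} (e : B ≅ B') : homDim k A B = homDim k A B' :=
  homDim_congr k (Iso.refl A) e

theorem homDim_map {D : Type*} [Category* D] [Preadditive D] [Linear k D]
    (F : C ⥤ D) [F.Additive] [F.Linear k] [F.Full] [F.Faithful] (A B : C) :
    homDim k (F.obj A) (F.obj B) = homDim k A B :=
  (LinearEquiv.ofBijective (F.mapLinearMap k)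
    ⟨F.map_injective, F.map_surjective⟩).finrank_eq.symm

section Monoidal

variable [MonoidalCategory C] [MonoidalPreadditive C] [MonoidalLinear k C]

theorem homDim_tensorLeft (A B Y Y' : C) [ExactPairing Y Y'] :
    homDim k (Y' ⊗ A) B = homDim k A (Y ⊗ B) :=
  LinearEquiv.finrank_eq
    { tensorLeftHomEquiv A Y Y' B with
      map_add' := fun f g => by simp [tensorLeftHomEquiv]
      map_smul' := fun r f => by simp [tensorLeftHomEquiv] }

theorem homDim_tensorRight (A B Y Y' : C) [ExactPairing Y Y'] :
    homDim k (A ⊗ Y) B = homDim k A (B ⊗ Y') :=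
  LinearEquiv.finrank_eq
    { tensorRightHomEquiv A Y Y' B with
      map_add' := fun f g => by simp [tensorRightHomEquiv]
      map_smul' := fun r f => by simp [tensorRightHomEquiv] }

theorem homDim_rightDual_self (X : C) [HasRightDual X] : homDim k Xᘁ Xᘁ = homDim k X X := by
  rw [homDim_congr_right k _ (λ_ Xᘁ).symm, ← homDim_tensorRight k Xᘁ (𝟙_ C) X Xᘁ,
    homDim_tensorLeft k X (𝟙_ C) X Xᘁ, homDim_congr_right k _ (ρ_ X)]

end Monoidal

section FiniteDimensional

variable [∀ X Y : C, FiniteDimensional k (X ⟶ Y)]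

theorem homDim_eq_zero_iff {A B : C} : homDim k A B = 0 ↔ ∀ f : A ⟶ B, f = 0 :=
  Module.finrank_zero_iff.trans (subsingleton_iff_forall_eq 0)

theorem homDim_ne_zero_iff {A B : C} : homDim k A B ≠ 0 ↔ ∃ f : A ⟶ B, f ≠ 0 := by
  simpa using (homDim_eq_zero_iff k).not

theorem isZero_iff_homDim_self {A : C} : IsZero A ↔ homDim k A A = 0 := by
  rw [homDim_eq_zero_iff]
  exact ⟨fun h f => h.eq_of_src f 0, fun h => (IsZero.iff_id_eq_zero A).2 (h (𝟙 A))⟩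

theorem homDim_biprod_left (A B X : C) [HasBinaryBiproduct A B] :
    homDim k (A ⊞ B) X = homDim k A X + homDim k B X := by
  unfold homDim
  rw [← Module.finrank_prod]
  exact LinearEquiv.finrank_eq
    { toFun := fun f => (biprod.inl ≫ f, biprod.inr ≫ f)
      invFun := fun p => biprod.desc p.1 p.2
      map_add' := fun f g => by simp
      map_smul' := fun r f => by simp
      left_inv := fun f => by ext <;> simp
      right_inv := fun p => by simp }

theorem homDim_biprod_right (X A B : C) [HasBinaryBiproduct A B] :
    homDim k X (A ⊞ B) = homDim k X A + homDim k X B := by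
  unfold homDim
  rw [← Module.finrank_prod]
  exact LinearEquiv.finrank_eq
    { toFun := fun f => (f ≫ biprod.fst, f ≫ biprod.snd)
      invFun := fun p => biprod.lift p.1 p.2
      map_add' := fun f g => by simp
      map_smul' := fun r f => by simp
      left_inv := fun f => by ext <;> simp
      right_inv := fun p => by simp }

end FiniteDimensional

end HomDim

section Simple

variable (k : Type*) [Field k] {C : Type*} [Category* C] [Abelian C] [Linear k C]
  [∀ X Y : C, FiniteDimensional k (X ⟶ Y)]

theorem homDim_ne_zero_iff_nonempty_iso {X Y : C} [Simple X] [Simple Y] :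
    homDim k X Y ≠ 0 ↔ Nonempty (X ≅ Y) := by
  rw [homDim_ne_zero_iff]
  constructor
  · rintro ⟨f, hf⟩
    have := isIso_of_hom_simple hf
    exact ⟨asIso f⟩
  · rintro ⟨e⟩
    exact ⟨e.hom, (isIso_iff_nonzero e.hom).1 inferInstance⟩

theorem homDim_simple_self [IsAlgClosed k] (X : C) [Simple X] : homDim k X X = 1 :=
  finrank_endomorphism_simple_eq_one k X

end Simple

theorem isSimpleConstituent_of_iso_biprod {C : Type*} [Category* C] [Abelian C] {S R W : C}
    [hS : Simple S] (e : W ≅ S ⊞ R) : IsSimpleConstituent S W :=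
  ⟨hS, biprod.inl ≫ e.inv, mono_comp _ _⟩

section Rigid

variable {C : Type*} [Category* C] [MonoidalCategory C]

section Preadditive

variable [Preadditive C] [MonoidalPreadditive C] {X X' : C} [ExactPairing X X']

theorem evaluation_ne_zero (hX : ¬ IsZero X) : ε_ X X' ≠ 0 := fun hε => hX <| by
  have zigzag := ExactPairing.evaluation_coevaluation X X'
  rw [hε, MonoidalPreadditive.whiskerLeft_zero, comp_zero, comp_zero] at zigzag
  rw [IsZero.iff_id_eq_zero, ← cancel_mono (ρ_ X).inv, ← cancel_epi (λ_ X).hom]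
  simpa using zigzag.symm

theorem coevaluation_ne_zero (hX : ¬ IsZero X) : η_ X X' ≠ 0 := fun hη => hX <| by
  have zigzag := ExactPairing.evaluation_coevaluation X X'
  rw [hη, MonoidalPreadditive.zero_whiskerRight, zero_comp] at zigzag
  rw [IsZero.iff_id_eq_zero, ← cancel_mono (ρ_ X).inv, ← cancel_epi (λ_ X).hom]
  simpa using zigzag.symm

theorem isZero_tensor_right (A : C) {B : C} (hB : IsZero B) : IsZero (A ⊗ B) :=
  (tensorLeft A).map_isZero hB

theorem isZero_tensor_left {A : C} (hA : IsZero A) (B : C) : IsZero (A ⊗ B) :=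
  (tensorRight B).map_isZero hA

end Preadditive

variable [Abelian C] [MonoidalPreadditive C] [RigidCategory C] [Simple (𝟙_ C)]

theorem not_isZero_tensor {X Y : C} (hX : ¬ IsZero X) (hY : ¬ IsZero Y) : ¬ IsZero (X ⊗ Y) := by
  intro hXY
  have : Epi (ε_ X Xᘁ) := epi_of_nonzero_to_simple (evaluation_ne_zero hX)
  have : Mono (η_ Y Yᘁ) := mono_of_nonzero_from_simple (coevaluation_ne_zero hY)
  have hzero : ε_ X Xᘁ ≫ η_ Y Yᘁ = 0 := by
    apply (tensorLeftHomEquiv X X Xᘁ (Y ⊗ Yᘁ)).injective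
    exact ((isZero_tensor_left hXY Yᘁ).of_iso (α_ X Y Yᘁ).symm).eq_of_tgt _ _
  apply evaluation_ne_zero (X' := Xᘁ) hX
  rw [← cancel_mono (η_ Y Yᘁ), hzero, zero_comp]

end Rigid

section Semisimple

variable (k : Type*) [Field k] {C : Type*} [Category* C] [Abelian C] [Linear k C]
  [MonoidalCategory C] [MonoidalPreadditive C] [MonoidalLinear k C] [RigidCategory C]
  [IsFusionCategory k C]

instance IsFusionCategory.finiteDimensional (X Y : C) :
    FiniteDimensional k (X ⟶ Y) :=
  IsFusionCategory.finiteDimensional_hom X Y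

include k in
theorem exists_iso_biprod_of_ne_zero {S W : C} [Simple S] {f : S ⟶ W} (hf : f ≠ 0) :
    ∃ R, Nonempty (W ≅ S ⊞ R) := by
  obtain ⟨m, T, hT, ⟨e⟩⟩ := IsFusionCategory.semisimple (k := k) W
  obtain ⟨i, hi⟩ : ∃ i, f ≫ e.hom ≫ biproduct.π T i ≠ 0 := by
    by_contra! hzero
    refine hf ((cancel_mono e.hom).1 (biproduct.hom_ext _ _ fun i => ?_))
    rw [Category.assoc, hzero i, zero_comp, zero_comp]
  have := isIso_of_hom_simple hi
  have : IsSplitMono f :=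
    .mk' ⟨(e.hom ≫ biproduct.π T i) ≫ inv (f ≫ e.hom ≫ biproduct.π T i), by
      rw [← Category.assoc, IsIso.hom_inv_id]⟩
  exact ⟨_, ⟨biprod.uniqueUpToIso _ _
    (isBilimitBinaryBiconeOfIsSplitMonoOfCokernel (cokernelIsCokernel f))⟩⟩

include k in
theorem isZero_or_exists_iso_biprod (X : C) :
    IsZero X ∨ ∃ S R : C, Simple S ∧ Nonempty (X ≅ S ⊞ R) := by
  obtain ⟨m, S, hS, ⟨e⟩⟩ := IsFusionCategory.semisimple (k := k) X
  rcases isEmpty_or_nonempty (Fin m) with hm | ⟨⟨i⟩⟩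
  · exact .inl (((IsZero.iff_id_eq_zero _).2 (biproduct.hom_ext _ _ hm.elim)).of_iso e)
  · have := hS i
    obtain ⟨R, e'⟩ := exists_iso_biprod_of_ne_zero k (f := biproduct.ι S i ≫ e.inv)
      fun h0 => Simple.not_isZero (S i) (IsZero.of_mono_eq_zero _ h0)
    exact .inr ⟨S i, R, hS i, e'⟩

include k in
theorem semisimple_induction {P : C → Prop} (iso : ∀ {X Y : C}, (X ≅ Y) → P X → P Y)
    (zero : ∀ {X : C}, IsZero X → P X)
    (biprod : ∀ S R : C, Simple S → P R → P (S ⊞ R)) (X : C) : P X := by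
  induction hn : homDim k X X using Nat.strong_induction_on generalizing X with
  | _ n ih =>
    obtain hX | ⟨S, R, hS, ⟨e⟩⟩ := isZero_or_exists_iso_biprod k X
    · exact zero hX
    · refine iso e.symm (biprod S R hS (ih _ ?_ R rfl))
      have hSS := (isZero_iff_homDim_self k).not.1 (Simple.not_isZero S)
      rw [← hn, homDim_congr k e e, homDim_biprod_left, homDim_biprod_right, homDim_biprod_right]
      omega

theorem simple_iff_homDim_self [IsAlgClosed k] {X : C} : Simple X ↔ homDim k X X = 1 := by
  refine ⟨fun _ => homDim_simple_self k X, fun hX => ?_⟩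
  obtain hzero | ⟨S, R, hS, ⟨e⟩⟩ := isZero_or_exists_iso_biprod k X
  · rw [(isZero_iff_homDim_self k).1 hzero] at hX
    exact absurd hX zero_ne_one
  · rw [homDim_congr k e e, homDim_biprod_left, homDim_biprod_right, homDim_biprod_right,
      homDim_simple_self] at hX
    have hR : IsZero R := (isZero_iff_homDim_self k).2 (by omega)
    exact Simple.of_iso (e ≪≫ (isoBiprodZero hR).symm)

include k in
theorem simple_rightDual [IsAlgClosed k] (X : C) [Simple X] : Simple Xᘁ :=
  (simple_iff_homDim_self k).2 ((homDim_rightDual_self k X).trans (homDim_simple_self k X))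

end Semisimple

section Irr

variable {C : Type*} [Category* C] [HasZeroMorphisms C]

/-- The isomorphism class of a simple object. -/
def Irr.mk (X : C) [hX : Simple X] : Irr C := Quotient.mk (simpleSetoid C) ⟨X, hX⟩

instance Irr.simple_obj (x : Irr C) : Simple x.obj := (Quotient.out (s := simpleSetoid C) x).2

theorem Irr.nonempty_mk_obj_iso (X : C) [hX : Simple X] : Nonempty ((Irr.mk X).obj ≅ X) :=
  Quotient.mk_out (s := simpleSetoid C) ⟨X, hX⟩

theorem Irr.eq_of_iso {x y : Irr C} (e : x.obj ≅ y.obj) : x = y :=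
  Quotient.out_equiv_out.1 ⟨e⟩

theorem Irr.eq_mk_iff {X : C} [Simple X] {x : Irr C} : x = Irr.mk X ↔ Nonempty (x.obj ≅ X) := by
  obtain ⟨e⟩ := Irr.nonempty_mk_obj_iso X
  refine ⟨?_, fun ⟨f⟩ => Irr.eq_of_iso (f ≪≫ e.symm)⟩
  rintro rfl
  exact ⟨e⟩

end Irr

section Grading

namespace Grading

variable {C : Type*} [Category* C] [Abelian C] [MonoidalCategory C] {G : Type*} [Group G]
  (𝒢 : Grading C G)

theorem eq_of_component {g h : G} {X : C} (hX : ¬ IsZero X) (hg : 𝒢.component g X)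
    (hh : 𝒢.component h X) : g = h := by
  by_contra hne
  exact hX ((IsZero.iff_id_eq_zero X).2 (𝒢.hom_eq_zero hne hg hh _))

theorem component_of_orthogonal {g : G} {W : C}
    (hW : ∀ h, h ≠ g → ∀ V, 𝒢.component h V → ∀ f : V ⟶ W, f = 0) : 𝒢.component g W := by
  obtain ⟨s, Z, hZ, ⟨e⟩⟩ := 𝒢.decomposition W
  have hzero (j : s) (hj : j.1 ≠ g) : IsZero (Z j) :=
    IsZero.of_mono_eq_zero (biproduct.ι Z j ≫ e.inv) (hW j.1 hj (Z j) (hZ j) _)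
  by_cases hg : g ∈ s
  · refine 𝒢.iso (⟨biproduct.ι Z ⟨g, hg⟩, biproduct.π Z ⟨g, hg⟩, by simp, ?_⟩ ≪≫ e.symm)
      (hZ ⟨g, hg⟩)
    refine biproduct.hom_ext' _ _ fun j => ?_
    by_cases hj : j = ⟨g, hg⟩
    · subst hj
      simp
    · exact (hzero j fun hjg => hj (Subtype.ext hjg)).eq_of_src _ _
  · refine 𝒢.zero g (((IsZero.iff_id_eq_zero _).2 ?_).of_iso e)
    refine biproduct.hom_ext' _ _ fun j => (hzero j ?_).eq_of_src _ _
    rintro rfl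
    exact hg j.2

theorem component_of_mono {g : G} {A W : C} (f : A ⟶ W) [Mono f] (hW : 𝒢.component g W) :
    𝒢.component g A :=
  𝒢.component_of_orthogonal fun _ hh _ hV a => by
    rw [← cancel_mono f, zero_comp]
    exact 𝒢.hom_eq_zero hh hV hW _

theorem exists_component_of_simple (S : C) [Simple S] : ∃ g, 𝒢.component g S := by
  obtain ⟨s, Z, hZ, ⟨e⟩⟩ := 𝒢.decomposition S
  obtain ⟨j, hj⟩ : ∃ j, biproduct.ι Z j ≫ e.inv ≠ 0 := by
    by_contra! hzero
    refine Simple.not_isZero S ((IsZero.iff_id_eq_zero S).2 ?_)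
    refine (cancel_epi e.inv).1 (biproduct.hom_ext' _ _ fun j => ?_)
    rw [← Category.assoc, hzero j, zero_comp, comp_zero, comp_zero]
  have := isIso_of_mono_of_nonzero hj
  exact ⟨j, 𝒢.iso (asIso (biproduct.ι Z j ≫ e.inv)) (hZ j)⟩

theorem component_one_of_isSimpleConstituent_tensor_self {S : C}
    (hS : IsSimpleConstituent S (S ⊗ S)) : 𝒢.component 1 S := by
  obtain ⟨_, f, _⟩ := hS
  obtain ⟨g, hg⟩ := 𝒢.exists_component_of_simple S
  have hg1 : g = g * g :=
    𝒢.eq_of_component (Simple.not_isZero S) hg (𝒢.component_of_mono f (𝒢.tensor hg hg))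
  rwa [left_eq_mul.1 hg1] at hg

theorem component_one_unit [Simple (𝟙_ C)] : 𝒢.component 1 (𝟙_ C) :=
  𝒢.component_one_of_isSimpleConstituent_tensor_self ⟨‹_›, (λ_ (𝟙_ C)).inv, inferInstance⟩

section Rigid

variable [RigidCategory C] [Simple (𝟙_ C)]

theorem component_rightDual {g : G} {X : C} (hX : 𝒢.component g X) : 𝒢.component g⁻¹ Xᘁ :=
  𝒢.component_of_orthogonal fun h hh V hV f => by
    apply (cancel_mono (λ_ Xᘁ).inv).1
    apply (tensorRightHomEquiv V X Xᘁ (𝟙_ C)).symm.injective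
    have hne : h * g ≠ 1 := fun e => hh (eq_inv_of_mul_eq_one_left e)
    have hzero := 𝒢.hom_eq_zero hne (𝒢.tensor hV hX) 𝒢.component_one_unit
    exact (hzero _).trans (hzero _).symm

theorem component_leftDual {g : G} {X : C} (hX : 𝒢.component g X) : 𝒢.component g⁻¹ (ᘁX) :=
  𝒢.component_of_orthogonal fun h hh V hV f => by
    apply (cancel_mono (ρ_ (ᘁX)).inv).1
    apply (tensorLeftHomEquiv V (ᘁX) X (𝟙_ C)).symm.injective
    have hne : g * h ≠ 1 := fun e => hh (eq_inv_of_mul_eq_one_right e)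
    have hzero := 𝒢.hom_eq_zero hne (𝒢.tensor hX hV) 𝒢.component_one_unit
    exact (hzero _).trans (hzero _).symm

theorem isFusionSubcategory_component_one : IsFusionSubcategory (𝒢.component 1) where
  iso := 𝒢.iso
  unit := 𝒢.component_one_unit
  tensor hX hY := by simpa using 𝒢.tensor hX hY
  rightDual hX := by simpa using 𝒢.component_rightDual hX
  leftDual hX := by simpa using 𝒢.component_leftDual hX
  zero := 𝒢.zero 1
  biprod hX hY := 𝒢.component_of_orthogonal fun _ hh _ hV f => by
    ext
    · simpa using 𝒢.hom_eq_zero hh hV hX (f ≫ biprod.fst)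
    · simpa using 𝒢.hom_eq_zero hh hV hY (f ≫ biprod.snd)
  summand h := 𝒢.component_of_mono biprod.inl h

theorem component_one_tensor_rightDual {g : G} {X Y : C} (hX : 𝒢.component g X)
    (hY : 𝒢.component g Y) : 𝒢.component 1 (X ⊗ Yᘁ) := by
  simpa using 𝒢.tensor hX (𝒢.component_rightDual hY)

theorem adjointSubcategory_le_component_one : adjointSubcategory C ≤ 𝒢.component 1 := by
  intro Z hZ
  refine hZ _ 𝒢.isFusionSubcategory_component_one fun X S hX ⟨_, f, _⟩ => ?_
  obtain ⟨g, hg⟩ := 𝒢.exists_component_of_simple X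
  exact 𝒢.component_of_mono f (𝒢.component_one_tensor_rightDual hg hg)

end Rigid

/-- The degree of a simple object: the `g` for which it lies in the component of degree `g`. -/
noncomputable def degree (x : Irr C) : G := (𝒢.exists_component_of_simple x.obj).choose

theorem component_degree (x : Irr C) : 𝒢.component (𝒢.degree x) x.obj :=
  (𝒢.exists_component_of_simple x.obj).choose_spec

theorem mem_irr_iff {g : G} {x : Irr C} : x ∈ 𝒢.irr g ↔ 𝒢.degree x = g := by
  refine ⟨fun hx => 𝒢.eq_of_component (Simple.not_isZero x.obj) (𝒢.component_degree x) hx, ?_⟩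
  rintro rfl
  exact 𝒢.component_degree x

theorem mk_mem_irr_iff {g : G} {X : C} [Simple X] : Irr.mk X ∈ 𝒢.irr g ↔ 𝒢.component g X := by
  obtain ⟨e⟩ := Irr.nonempty_mk_obj_iso X
  exact ⟨𝒢.iso e, 𝒢.iso e.symm⟩

theorem degree_eq_mul {x y z : Irr C} (h : IsSimpleConstituent z.obj (x.obj ⊗ y.obj)) :
    𝒢.degree z = 𝒢.degree x * 𝒢.degree y := by
  obtain ⟨_, f, _⟩ := h
  exact 𝒢.mem_irr_iff.1 (𝒢.component_of_mono f
    (𝒢.tensor (𝒢.component_degree x) (𝒢.component_degree y)))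

/-- The homomorphism from the universal grading group to `G` induced by a `G`-grading. -/
noncomputable def fromUniversal : UniversalGradingGroup C →* G :=
  PresentedGroup.toGroup (f := 𝒢.degree) (by
    rintro r ⟨x, y, z, hz, rfl⟩
    simp [𝒢.degree_eq_mul hz])

theorem fromUniversal_universalDegree (x : Irr C) :
    𝒢.fromUniversal (universalDegree x) = 𝒢.degree x :=
  PresentedGroup.toGroup.of _

end Grading

end Grading

section UniversalGrading

theorem universalDegree_eq_mul {C : Type*} [Category* C] [Abelian C] [MonoidalCategory C]
    {x y z : Irr C} (h : IsSimpleConstituent z.obj (x.obj ⊗ y.obj)) :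
    universalDegree z = universalDegree x * universalDegree y :=
  (PresentedGroup.mk_eq_mk_of_mul_inv_mem ⟨x, y, z, h, rfl⟩ :
    universalDegree x * universalDegree y = universalDegree z).symm

theorem universalDegree_eq_one_of_isSimpleConstituent {C : Type*} [Category* C] [Abelian C]
    [MonoidalCategory C] {x : Irr C} (h : IsSimpleConstituent x.obj (x.obj ⊗ x.obj)) :
    universalDegree x = 1 :=
  left_eq_mul.1 (universalDegree_eq_mul h)

theorem IsSimpleConstituent.congr {C : Type*} [Category* C] [Abelian C] {S S' X X' : C}
    (h : IsSimpleConstituent S X) (e : S ≅ S') (e' : X ≅ X') : IsSimpleConstituent S' X' := by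
  obtain ⟨_, f, _⟩ := h
  exact ⟨Simple.of_iso e.symm, e.inv ≫ f ≫ e'.hom, inferInstance⟩

variable (k : Type*) [Field k] {C : Type*} [Category* C] [Abelian C] [Linear k C]
  [MonoidalCategory C] [MonoidalPreadditive C] [MonoidalLinear k C] [RigidCategory C]
  [IsFusionCategory k C]

include k in
theorem exists_isSimpleConstituent {X : C} (hX : ¬ IsZero X) :
    ∃ z : Irr C, IsSimpleConstituent z.obj X := by
  obtain ⟨S, R, hS, ⟨e⟩⟩ := (isZero_or_exists_iso_biprod k X).resolve_left hX
  obtain ⟨f⟩ := Irr.nonempty_mk_obj_iso S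
  exact ⟨Irr.mk S, (isSimpleConstituent_of_iso_biprod e).congr f.symm (Iso.refl X)⟩

include k in
theorem universalDegree_surjective [IsAlgClosed k] :
    Function.Surjective (universalDegree (C := C)) := by
  have : Simple (𝟙_ C) := IsFusionCategory.simple_unit k
  have hunit : universalDegree (Irr.mk (𝟙_ C)) = 1 := by
    obtain ⟨e⟩ := Irr.nonempty_mk_obj_iso (𝟙_ C)
    exact universalDegree_eq_one_of_isSimpleConstituent
      ⟨inferInstance, (whiskerLeftIso _ e ≪≫ ρ_ (Irr.mk (𝟙_ C)).obj).inv, inferInstance⟩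
  let H : Subgroup (UniversalGradingGroup C) :=
    { carrier := Set.range universalDegree
      one_mem' := ⟨_, hunit⟩
      mul_mem' := by
        rintro _ _ ⟨x, rfl⟩ ⟨y, rfl⟩
        obtain ⟨z, hz⟩ := exists_isSimpleConstituent k
          (not_isZero_tensor (Simple.not_isZero x.obj) (Simple.not_isZero y.obj))
        exact ⟨z, universalDegree_eq_mul hz⟩
      inv_mem' := by
        rintro _ ⟨x, rfl⟩
        have hη : IsSimpleConstituent (𝟙_ C) (x.obj ⊗ x.objᘁ) :=
          ⟨inferInstance, η_ x.obj x.objᘁ,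
            mono_of_nonzero_from_simple (coevaluation_ne_zero (Simple.not_isZero x.obj))⟩
        have := simple_rightDual k x.obj
        obtain ⟨e⟩ := Irr.nonempty_mk_obj_iso (𝟙_ C)
        obtain ⟨f⟩ := Irr.nonempty_mk_obj_iso x.objᘁ
        refine ⟨Irr.mk x.objᘁ, eq_inv_of_mul_eq_one_right ?_⟩
        rw [← universalDegree_eq_mul (hη.congr e.symm (whiskerLeftIso _ f.symm)), hunit] }
  exact fun u => PresentedGroup.generated_by _ H (fun x => ⟨x, rfl⟩) u

end UniversalGrading

namespace Grading

variable (k : Type*) [Field k] [IsAlgClosed k] {C : Type*} [Category* C] [Abelian C] [Linear k C]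
  [MonoidalCategory C] [MonoidalPreadditive C] [MonoidalLinear k C] [RigidCategory C]
  [IsFusionCategory k C] {G : Type*} [Group G] (𝒢 : Grading C G)

include k in
theorem fromUniversal_injective (h : ∀ x ∈ 𝒢.irr 1, universalDegree x = 1) :
    Function.Injective 𝒢.fromUniversal := by
  refine (injective_iff_map_eq_one _).2 fun u hu => ?_
  obtain ⟨x, rfl⟩ := universalDegree_surjective k u
  exact h x (𝒢.mem_irr_iff.2 (by rwa [← 𝒢.fromUniversal_universalDegree]))

end Grading

section Invertible

/-- Invertible objects: `invertibles C` consists of the classes of these. -/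
def IsInvertible {C : Type*} [Category* C] [MonoidalCategory C] [RigidCategory C] (X : C) :
    Prop :=
  Nonempty (X ⊗ Xᘁ ≅ 𝟙_ C)

namespace IsInvertible

variable (k : Type*) [Field k] {C : Type*} [Category* C] [Abelian C] [Linear k C]
  [MonoidalCategory C] [MonoidalPreadditive C] [MonoidalLinear k C] [RigidCategory C]
  {D : C} (hD : IsInvertible D)

include hD

theorem homDim_rightDual_tensor (A B : C) : homDim k (Dᘁ ⊗ A) (Dᘁ ⊗ B) = homDim k A B := by
  obtain ⟨e⟩ := hD
  rw [homDim_tensorLeft k A (Dᘁ ⊗ B) D Dᘁ,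
    homDim_congr_right k A ((α_ D Dᘁ B).symm ≪≫ whiskerRightIso e B ≪≫ λ_ B)]

variable [IsFusionCategory k C] [IsAlgClosed k]

include k in
theorem nonempty_rightDual_tensor_iso : Nonempty (Dᘁ ⊗ D ≅ 𝟙_ C) := by
  have : Simple (𝟙_ C) := IsFusionCategory.simple_unit k
  have hDD : homDim k D D = 1 := by
    obtain ⟨e⟩ := hD
    rw [homDim_congr_left k (λ_ D).symm, homDim_tensorRight k (𝟙_ C) D D Dᘁ,
      homDim_congr_right k _ e, homDim_simple_self]
  have : Simple D := (simple_iff_homDim_self k).2 hDD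
  have : Simple (Dᘁ ⊗ D) :=
    (simple_iff_homDim_self k).2 ((hD.homDim_rightDual_tensor k D D).trans hDD)
  have := isIso_of_hom_simple (evaluation_ne_zero (X' := Dᘁ) (Simple.not_isZero D))
  exact ⟨asIso (ε_ D Dᘁ)⟩

theorem homDim_tensor (A B : C) : homDim k (D ⊗ A) (D ⊗ B) = homDim k A B := by
  obtain ⟨e⟩ := hD.nonempty_rightDual_tensor_iso k
  have cancel (X : C) : Dᘁ ⊗ (D ⊗ X) ≅ X := (α_ Dᘁ D X).symm ≪≫ whiskerRightIso e X ≪≫ λ_ X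
  rw [← hD.homDim_rightDual_tensor k, homDim_congr k (cancel A) (cancel B)]

include k in
theorem simple_tensor_iff {A : C} : Simple (D ⊗ A) ↔ Simple A := by
  rw [simple_iff_homDim_self k, hD.homDim_tensor k, simple_iff_homDim_self k]

include k in
theorem simple : Simple D := by
  have : Simple (D ⊗ 𝟙_ C) := (hD.simple_tensor_iff k).2 (IsFusionCategory.simple_unit k)
  exact Simple.of_iso (ρ_ D).symm

end IsInvertible

end Invertible

section Fibonacci

attribute [local instance] preservesBinaryBiproducts_of_preservesBiproducts

/-- Fibonacci objects: simple `T` obeying the fusion rule `T ⊗ T ≅ 𝟙 ⊕ T` of the nontrivial simple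
object of a Yang–Lee category. -/
structure IsFibonacci {C : Type*} [Category* C] [Abelian C] [MonoidalCategory C] (T : C) :
    Prop where
  simple : Simple T
  nonempty_tensor_self_iso : Nonempty (T ⊗ T ≅ 𝟙_ C ⊞ T)

namespace IsFibonacci

theorem map {C D : Type*} [Category* C] [Abelian C] [MonoidalCategory C] [Category* D] [Abelian D]
    [MonoidalCategory D] (F : C ⥤ D) [F.Monoidal] [F.Additive] {T : C} (hT : IsFibonacci T)
    (hFT : Simple (F.obj T)) : IsFibonacci (F.obj T) := by
  obtain ⟨e⟩ := hT.nonempty_tensor_self_iso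
  exact ⟨hFT, ⟨Functor.Monoidal.μIso F T T ≪≫ F.mapIso e ≪≫ F.mapBiprod _ _ ≪≫
    biprod.mapIso (Functor.Monoidal.εIso F).symm (Iso.refl _)⟩⟩

variable {C : Type*} [Category* C] [Abelian C] [MonoidalCategory C] {T : C} (hT : IsFibonacci T)

include hT

theorem isSimpleConstituent_tensor_self : IsSimpleConstituent T (T ⊗ T) := by
  obtain ⟨e⟩ := hT.nonempty_tensor_self_iso
  exact ⟨hT.simple, biprod.inr ≫ e.inv, inferInstance⟩

variable [MonoidalPreadditive C]

theorem nonempty_tensor_tensor_iso (X : C) : Nonempty (T ⊗ (T ⊗ X) ≅ X ⊞ T ⊗ X) := by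
  obtain ⟨e⟩ := hT.nonempty_tensor_self_iso
  exact ⟨(α_ T T X).symm ≪≫ whiskerRightIso e X ≪≫ (tensorRight X).mapBiprod (𝟙_ C) T ≪≫
    biprod.mapIso (λ_ X) (Iso.refl _)⟩

variable (k : Type*) [Field k] [Linear k C] [MonoidalLinear k C] [RigidCategory C]
  [IsFusionCategory k C]

theorem homDim_tensor_tensor (X Z : C) :
    homDim k (T ⊗ (T ⊗ X)) Z = homDim k X Z + homDim k (T ⊗ X) Z := by
  obtain ⟨e⟩ := hT.nonempty_tensor_tensor_iso X
  rw [homDim_congr_left k e, homDim_biprod_left]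

variable [IsAlgClosed k]

include k in
theorem nonempty_iso_rightDual : Nonempty (T ≅ Tᘁ) := by
  have := hT.simple
  have : Simple (𝟙_ C) := IsFusionCategory.simple_unit k
  have := simple_rightDual k T
  obtain ⟨e⟩ := hT.nonempty_tensor_self_iso
  rw [← homDim_ne_zero_iff_nonempty_iso k, homDim_congr_right k T (λ_ Tᘁ).symm,
    ← homDim_tensorRight k T (𝟙_ C) T Tᘁ, homDim_congr_left k e, homDim_biprod_left,
    homDim_simple_self]
  omega

theorem homDim_tensor_comm (X Z : C) : homDim k (T ⊗ X) Z = homDim k X (T ⊗ Z) := by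
  obtain ⟨e⟩ := hT.nonempty_iso_rightDual k
  rw [homDim_congr_left k (whiskerRightIso e X), homDim_tensorLeft k X Z T Tᘁ]

theorem homDim_unit : homDim k T (𝟙_ C) = 0 := by
  have := hT.simple
  have : Simple (𝟙_ C) := IsFusionCategory.simple_unit k
  have hself := hT.homDim_tensor_comm k T (𝟙_ C)
  obtain ⟨e⟩ := hT.nonempty_tensor_self_iso
  rw [homDim_congr_left k e, homDim_biprod_left, homDim_congr_right k T (ρ_ T),
    homDim_simple_self, homDim_simple_self] at hself
  omega

theorem simple_tensor_iff {X : C} [Simple X] : Simple (T ⊗ X) ↔ homDim k (T ⊗ X) X = 0 := by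
  rw [simple_iff_homDim_self k, ← hT.homDim_tensor_comm, hT.homDim_tensor_tensor,
    homDim_simple_self]
  omega

include k in
theorem not_simple_tensor_tensor {X : C} [Simple (T ⊗ X)] : ¬ Simple (T ⊗ (T ⊗ X)) := by
  rw [hT.simple_tensor_iff k, hT.homDim_tensor_tensor, homDim_simple_self]
  omega

include k in
/-- If `r` is the multiplicity of `X` in `R`, counting the endomorphisms of `T ⊗ X ≅ X ⊕ R` in two
ways gives `r + dim End R = 1`. -/
theorem exists_iso_tensor {X : C} [hX : Simple X] (hTX : ¬ Simple (T ⊗ X)) :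
    ∃ R : C, Simple R ∧ Simple (T ⊗ R) ∧ Nonempty (X ≅ T ⊗ R) := by
  have hm := (hT.simple_tensor_iff k).not.1 hTX
  obtain ⟨f, hf⟩ := (homDim_ne_zero_iff k).1 (hT.homDim_tensor_comm k X X ▸ hm)
  obtain ⟨R, ⟨e⟩⟩ := exists_iso_biprod_of_ne_zero k hf
  have hfrom (Z : C) : homDim k (T ⊗ X) Z = homDim k X Z + homDim k R Z := by
    rw [homDim_congr_left k e, homDim_biprod_left]
  have hto (Z : C) : homDim k Z (T ⊗ X) = homDim k Z X + homDim k Z R := by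
    rw [homDim_congr_right k Z e, homDim_biprod_right]
  have hXX := homDim_simple_self k X
  have hXR : homDim k X R = homDim k R X := by
    have := hT.homDim_tensor_comm k X X
    rw [hfrom, hto] at this
    omega
  have hend : homDim k R X + homDim k R R = 1 := by
    have := hT.homDim_tensor_comm k (T ⊗ X) X
    rw [hT.homDim_tensor_tensor k, hfrom, hto, hfrom, hfrom] at this
    omega
  have hRR : homDim k R R ≠ 0 := fun h0 => by
    have hRX := (homDim_eq_zero_iff k).2
      fun g : R ⟶ X => ((isZero_iff_homDim_self k).2 h0).eq_of_src g 0
    omega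
  have hR : Simple R := (simple_iff_homDim_self k).2 (by omega)
  have hXTR : homDim k X (T ⊗ R) = 1 := by
    rw [← hT.homDim_tensor_comm, hfrom]
    omega
  have hTR : homDim k (T ⊗ R) R = 0 := by
    have := hT.homDim_tensor_comm k (T ⊗ X) R
    rw [hT.homDim_tensor_tensor k, hfrom R, hfrom, hXTR, ← hT.homDim_tensor_comm k R R] at this
    omega
  have : Simple (T ⊗ R) := (hT.simple_tensor_iff k).2 hTR
  exact ⟨R, hR, this, (homDim_ne_zero_iff_nonempty_iso k).1 (by omega)⟩

end IsFibonacci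

end Fibonacci

section YangLeeExtension

/-- Gradings whose trivial component is a Yang–Lee category with nontrivial simple object `T`. -/
structure Grading.IsYangLeeExtension {C : Type*} [Category* C] [Abelian C] [MonoidalCategory C]
    {G : Type*} [Group G] (𝒢 : Grading C G) (T : C) : Prop extends IsFibonacci T where
  iso_or_iso : ∀ S : C, Simple S → 𝒢.component 1 S → Nonempty (S ≅ 𝟙_ C) ∨ Nonempty (S ≅ T)

namespace Grading.IsYangLeeExtension

variable {C : Type*} [Category* C] [Abelian C] [MonoidalCategory C] {G : Type*} [Group G]
  {𝒢 : Grading C G} {T : C} (hT : 𝒢.IsYangLeeExtension T)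

include hT

theorem component_one : 𝒢.component 1 T :=
  𝒢.component_one_of_isSimpleConstituent_tensor_self hT.isSimpleConstituent_tensor_self

theorem universalDegree_eq_one {x : Irr C} (hx : x ∈ 𝒢.irr 1) : universalDegree x = 1 := by
  apply universalDegree_eq_one_of_isSimpleConstituent
  obtain ⟨⟨e⟩⟩ | ⟨⟨e⟩⟩ := hT.iso_or_iso x.obj inferInstance hx
  · exact ⟨inferInstance, (whiskerLeftIso _ e ≪≫ ρ_ x.obj).inv, inferInstance⟩
  · exact hT.isSimpleConstituent_tensor_self.congr e.symm (e.symm ⊗ᵢ e.symm)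

variable (k : Type*) [Field k] [Linear k C] [MonoidalPreadditive C] [MonoidalLinear k C]
  [RigidCategory C] [IsFusionCategory k C]

include k

theorem homDim_ne_zero_of_component_one {W : C} (hW : 𝒢.component 1 W) (hzero : ¬ IsZero W) :
    homDim k (𝟙_ C) W ≠ 0 ∨ homDim k T W ≠ 0 := by
  obtain ⟨S, R, hS, ⟨e⟩⟩ := (isZero_or_exists_iso_biprod k W).resolve_left hzero
  have hSW : homDim k S W ≠ 0 := by
    have := (homDim_ne_zero_iff_nonempty_iso k).2 ⟨Iso.refl S⟩
    rw [homDim_congr_right k S e, homDim_biprod_right]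
    omega
  have hS1 : 𝒢.component 1 S := 𝒢.component_of_mono (biprod.inl ≫ e.inv) hW
  refine (hT.iso_or_iso S hS hS1).imp ?_ ?_ <;> rintro ⟨f⟩ <;>
    rwa [homDim_congr_left k f] at hSW

theorem component_one_le {P : ObjectProperty C} (hP : IsFusionSubcategory P) (hPT : P T) :
    𝒢.component 1 ≤ P := by
  refine semisimple_induction k (fun e ih hY => hP.iso e (ih (𝒢.iso e.symm hY)))
    (fun hX _ => hP.zero hX) fun S R hS ih hSR => ?_
  refine hP.biprod ?_ (ih (𝒢.component_of_mono biprod.inr hSR))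
  obtain ⟨⟨e⟩⟩ | ⟨⟨e⟩⟩ := hT.iso_or_iso S hS (𝒢.component_of_mono biprod.inl hSR)
  · exact hP.iso e.symm hP.unit
  · exact hP.iso e.symm hPT

variable [IsAlgClosed k]

theorem component_one_eq_adjointSubcategory : 𝒢.component 1 = adjointSubcategory C := by
  have : Simple (𝟙_ C) := IsFusionCategory.simple_unit k
  have := hT.simple
  obtain ⟨e⟩ := hT.nonempty_iso_rightDual k
  refine le_antisymm (fun Z hZ P hP hPad => ?_) 𝒢.adjointSubcategory_le_component_one
  exact hT.component_one_le k hP (hPad T T inferInstance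
    (hT.isSimpleConstituent_tensor_self.congr (Iso.refl T) (whiskerLeftIso T e))) Z hZ

theorem isInvertible_iff {X : C} [Simple X] : IsInvertible X ↔ Simple (T ⊗ X) := by
  have : Simple (𝟙_ C) := IsFusionCategory.simple_unit k
  rw [hT.simple_tensor_iff k, homDim_tensorRight k T X X Xᘁ]
  constructor
  · rintro ⟨e⟩
    rw [homDim_congr_right k T e, hT.homDim_unit]
  · intro hTX
    obtain ⟨R, ⟨e⟩⟩ := exists_iso_biprod_of_ne_zero k
      (coevaluation_ne_zero (X' := Xᘁ) (Simple.not_isZero X))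
    have h1X : homDim k (𝟙_ C) (X ⊗ Xᘁ) = 1 := by
      rw [← homDim_tensorRight k (𝟙_ C) X X Xᘁ, homDim_congr_left k (λ_ X), homDim_simple_self]
    rw [homDim_congr_right k _ e, homDim_biprod_right] at h1X hTX
    rw [homDim_simple_self] at h1X
    obtain ⟨g, hg⟩ := 𝒢.exists_component_of_simple X
    have hR1 : 𝒢.component 1 R :=
      𝒢.component_of_mono (biprod.inr ≫ e.inv) (𝒢.component_one_tensor_rightDual hg hg)
    have hR : IsZero R := by
      by_contra hR
      obtain h | h := hT.homDim_ne_zero_of_component_one k hR1 hR <;> omega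
    exact ⟨e ≪≫ (isoBiprodZero hR).symm⟩

theorem mk_mem_invertibles_iff {X : C} [Simple X] : Irr.mk X ∈ invertibles C ↔ Simple (T ⊗ X) := by
  obtain ⟨e⟩ := Irr.nonempty_mk_obj_iso X
  exact (hT.isInvertible_iff k).trans (Simple.iff_of_iso (whiskerLeftIso T e))

theorem nonempty_iso_or_homDim_ne_zero {g : G} {X Y : C} [Simple X] [Simple Y]
    (hX : 𝒢.component g X) (hY : 𝒢.component g Y) :
    Nonempty (X ≅ Y) ∨ homDim k (T ⊗ X) Y ≠ 0 := by
  have : Simple (𝟙_ C) := IsFusionCategory.simple_unit k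
  have := simple_rightDual k X
  have hW := hT.homDim_ne_zero_of_component_one k (𝒢.component_one_tensor_rightDual hY hX)
    (not_isZero_tensor (Simple.not_isZero Y) (Simple.not_isZero Xᘁ))
  rwa [← homDim_tensorRight k (𝟙_ C) Y X Xᘁ, ← homDim_tensorRight k T Y X Xᘁ,
    homDim_congr_left k (λ_ X), homDim_ne_zero_iff_nonempty_iso k] at hW

theorem nonempty_tensor_iso_comm {D : C} (hD : IsInvertible D) : Nonempty (T ⊗ D ≅ D ⊗ T) := by
  have := hT.simple
  have := hD.simple k
  have : Simple (T ⊗ D) := (hT.isInvertible_iff k).1 hD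
  have : Simple (D ⊗ T) := (hD.simple_tensor_iff k).2 hT.simple
  obtain ⟨g, hg⟩ := 𝒢.exists_component_of_simple D
  have hDT : 𝒢.component g (D ⊗ T) := by
    simpa using 𝒢.tensor hg hT.component_one
  rw [← homDim_ne_zero_iff_nonempty_iso k]
  refine (hT.nonempty_iso_or_homDim_ne_zero k hg hDT).resolve_left fun ⟨e⟩ => ?_
  have hTunit := hT.homDim_unit k
  rw [← hD.homDim_tensor k, homDim_congr k e.symm (ρ_ D), homDim_simple_self] at hTunit
  exact one_ne_zero hTunit

theorem exists_isInvertible (h𝒢 : 𝒢.IsFaithful) (g : G) :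
    ∃ D : C, IsInvertible D ∧ 𝒢.component g D := by
  obtain ⟨X, hX, hzero⟩ := h𝒢 g
  obtain ⟨S, R, hS, ⟨e⟩⟩ := (isZero_or_exists_iso_biprod k X).resolve_left hzero
  have hSg : 𝒢.component g S := 𝒢.component_of_mono (biprod.inl ≫ e.inv) hX
  by_cases hTS : Simple (T ⊗ S)
  · exact ⟨S, (hT.isInvertible_iff k).2 hTS, hSg⟩
  · obtain ⟨R, hR, hTR, ⟨f⟩⟩ := hT.exists_iso_tensor k hTS
    obtain ⟨h, hh⟩ := 𝒢.exists_component_of_simple R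
    have hSh := 𝒢.tensor hT.component_one hh
    rw [one_mul] at hSh
    obtain rfl := 𝒢.eq_of_component (Simple.not_isZero S) hSg (𝒢.iso f.symm hSh)
    exact ⟨R, (hT.isInvertible_iff k).2 hTR, hh⟩

theorem exists_irr_eq_pair (h𝒢 : 𝒢.IsFaithful) (g : G) :
    ∃ δ y : Irr C, 𝒢.irr g = {δ, y} ∧ δ ∈ invertibles C ∧ y ∉ invertibles C := by
  obtain ⟨D, hD, hDg⟩ := hT.exists_isInvertible k h𝒢 g
  have := hD.simple k
  have hTD : Simple (T ⊗ D) := (hT.isInvertible_iff k).1 hD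
  have hTDg : 𝒢.component g (T ⊗ D) := by
    simpa using 𝒢.tensor hT.component_one hDg
  refine ⟨Irr.mk D, Irr.mk (T ⊗ D), Set.ext fun x => ⟨fun hx => ?_, ?_⟩,
    (hT.mk_mem_invertibles_iff k).2 hTD,
    (hT.mk_mem_invertibles_iff k).not.2 (hT.not_simple_tensor_tensor k)⟩
  · rw [Set.mem_insert_iff, Set.mem_singleton_iff, Irr.eq_mk_iff, Irr.eq_mk_iff]
    have h := hT.nonempty_iso_or_homDim_ne_zero k hDg hx
    rw [homDim_ne_zero_iff_nonempty_iso] at h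
    exact h.imp (fun ⟨e⟩ => ⟨e.symm⟩) (fun ⟨e⟩ => ⟨e.symm⟩)
  · rintro (rfl | rfl)
    · exact 𝒢.mk_mem_irr_iff.2 hDg
    · exact 𝒢.mk_mem_irr_iff.2 hTDg

end Grading.IsYangLeeExtension

end YangLeeExtension

section FrobeniusPerron

open Matrix in
theorem isGreatest_of_vecMul_eq_smul {n : Type*} [Fintype n] [Nonempty n] {M : Matrix n n ℝ}
    (hM : ∀ i j, 0 ≤ M i j) {d : n → ℝ} (hd : ∀ i, 0 < d i) {r : ℝ} (h : d ᵥ* M = r • d) :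
    IsGreatest {s : ℝ | 0 ≤ s ∧ ∃ v : n → ℝ, v ≠ 0 ∧ M *ᵥ v = s • v} r := by
  classical
  obtain ⟨i₀⟩ := ‹Nonempty n›
  refine ⟨⟨?_, ?_⟩, fun s ⟨hs, v, hv, hMv⟩ => ?_⟩
  · have hcol : 0 ≤ r * d i₀ := by
      rw [← smul_eq_mul, ← Pi.smul_apply, ← h]
      exact Finset.sum_nonneg fun i _ => mul_nonneg (hd i).le (hM i i₀)
    exact nonneg_of_mul_nonneg_left hcol (hd i₀)
  · have hsing : ∃ w ≠ 0, w ᵥ* (M - r • (1 : Matrix n n ℝ)) = 0 :=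
      ⟨d, fun h0 => (hd i₀).ne' (congrFun h0 i₀), by
        rw [vecMul_sub, h, vecMul_smul, vecMul_one, sub_self]⟩
    obtain ⟨v, hv, hMv⟩ := exists_mulVec_eq_zero_iff.2 (exists_vecMul_eq_zero_iff.1 hsing)
    refine ⟨v, hv, ?_⟩
    rwa [sub_mulVec, smul_mulVec, one_mulVec, sub_eq_zero] at hMv
  · have hpos : 0 < d ⬝ᵥ |v| := by
      obtain ⟨i, hi⟩ := Function.ne_iff.1 hv
      exact Finset.sum_pos' (fun j _ => mul_nonneg (hd j).le (abs_nonneg _))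
        ⟨i, Finset.mem_univ i, mul_pos (hd i) (abs_pos.2 hi)⟩
    have habs (i : n) : s * |v i| ≤ (M *ᵥ |v|) i := calc
      s * |v i| = |(M *ᵥ v) i| := by rw [hMv, Pi.smul_apply, smul_eq_mul, abs_mul, abs_of_nonneg hs]
      _ ≤ ∑ j, |M i j * v j| := Finset.abs_sum_le_sum_abs _ _
      _ = (M *ᵥ |v|) i := Finset.sum_congr rfl fun j _ => by
        rw [abs_mul, abs_of_nonneg (hM i j), Pi.abs_apply]
    refine le_of_mul_le_mul_right ?_ hpos
    calc
      s * (d ⬝ᵥ |v|) = d ⬝ᵥ (s • |v|) := by rw [dotProduct_smul, smul_eq_mul]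
      _ ≤ d ⬝ᵥ (M *ᵥ |v|) :=
        Finset.sum_le_sum fun i _ => mul_le_mul_of_nonneg_left (habs i) (hd i).le
      _ = r * (d ⬝ᵥ |v|) := by rw [dotProduct_mulVec, h, smul_dotProduct, smul_eq_mul]

attribute [local instance] preservesBinaryBiproducts_of_preservesBiproducts

variable (k : Type*) [Field k] {C : Type*} [Category* C] [Abelian C] [Linear k C]
  [MonoidalCategory C] [MonoidalPreadditive C] [MonoidalLinear k C] [RigidCategory C]
  [IsFusionCategory k C]

/-- The additive extension to all objects of a function `d` on the classes of simple objects. -/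
noncomputable def objDim (d : Irr C → ℝ) (Z : C) : ℝ :=
  haveI := finite_irr k C
  letI := Fintype.ofFinite (Irr C)
  ∑ x : Irr C, homDim k x.obj Z * d x

variable (d : Irr C → ℝ)

theorem objDim_congr {Z Z' : C} (e : Z ≅ Z') : objDim k d Z = objDim k d Z' := by
  unfold objDim
  simp only [homDim_congr_right k _ e]

theorem objDim_of_isZero {Z : C} (hZ : IsZero Z) : objDim k d Z = 0 := by
  have hzero (x : Irr C) : homDim k x.obj Z = 0 :=
    (homDim_eq_zero_iff k).2 fun f => hZ.eq_of_tgt f 0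
  simp only [objDim, hzero, Nat.cast_zero, zero_mul, Finset.sum_const_zero]

theorem objDim_biprod (A B : C) : objDim k d (A ⊞ B) = objDim k d A + objDim k d B := by
  simp only [objDim, homDim_biprod_right, Nat.cast_add, add_mul, Finset.sum_add_distrib]

theorem objDim_tensor_eq_mul {X : C} {r : ℝ}
    (h : ∀ S : C, Simple S → objDim k d (X ⊗ S) = r * objDim k d S) :
    ∀ Z : C, objDim k d (X ⊗ Z) = r * objDim k d Z := by
  refine semisimple_induction k (fun e ih => ?_) (fun hZ => ?_) fun S R hS ih => ?_
  · rwa [← objDim_congr k d e, ← objDim_congr k d (whiskerLeftIso X e)]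
  · rw [objDim_of_isZero k d hZ, objDim_of_isZero k d (isZero_tensor_right X hZ), mul_zero]
  · have e : X ⊗ (S ⊞ R) ≅ (X ⊗ S) ⊞ (X ⊗ R) := (tensorLeft X).mapBiprod S R
    rw [objDim_congr k d e, objDim_biprod, objDim_biprod, h S hS, ih, mul_add]

theorem objDim_obj [IsAlgClosed k] (x : Irr C) : objDim k d x.obj = d x := by
  have := finite_irr k C
  let := Fintype.ofFinite (Irr C)
  have hzero (y : Irr C) (hyx : y ≠ x) : homDim k y.obj x.obj = 0 := by
    contrapose! hyx
    obtain ⟨e⟩ := (homDim_ne_zero_iff_nonempty_iso k).1 hyx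
    exact Irr.eq_of_iso e
  calc
    objDim k d x.obj = ∑ y : Irr C, homDim k y.obj x.obj * d y := rfl
    _ = homDim k x.obj x.obj * d x := Finset.sum_eq_single_of_mem x (Finset.mem_univ x)
      fun y _ hyx => by rw [hzero y hyx, Nat.cast_zero, zero_mul]
    _ = d x := by rw [homDim_simple_self, Nat.cast_one, one_mul]

theorem objDim_simple [IsAlgClosed k] (S : C) [Simple S] : objDim k d S = d (Irr.mk S) := by
  obtain ⟨e⟩ := Irr.nonempty_mk_obj_iso S
  rw [← objDim_congr k d e, objDim_obj]

variable {d}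

theorem FPdim_eq_of_objDim_tensor (hd : ∀ x, 0 < d x) {x : Irr C} {r : ℝ}
    (h : ∀ y : Irr C, objDim k d (x.obj ⊗ y.obj) = r * d y) : FPdim k x = r := by
  have := finite_irr k C
  let := Fintype.ofFinite (Irr C)
  have : Nonempty (Irr C) := ⟨x⟩
  refine (isGreatest_of_vecMul_eq_smul (M := leftMulMatrix k x) (fun _ _ => Nat.cast_nonneg _) hd
    (funext fun y => ?_)).csSup_eq
  rw [Pi.smul_apply, smul_eq_mul, ← h y]
  exact Finset.sum_congr rfl fun z _ => mul_comm _ _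

end FrobeniusPerron

section YangLeeDim

open scoped Classical in
/-- The values taken by the Frobenius–Perron dimension in an extension of a Yang–Lee category:
`1` on invertible objects and the golden ratio on the other simple objects. -/
noncomputable def yangLeeDim {C : Type*} [Category* C] [Abelian C] [MonoidalCategory C]
    [RigidCategory C] (x : Irr C) : ℝ :=
  if x ∈ invertibles C then 1 else Real.goldenRatio

section

variable {C : Type*} [Category* C] [Abelian C] [MonoidalCategory C] [RigidCategory C] {x : Irr C}

theorem yangLeeDim_eq_one_iff : yangLeeDim x = 1 ↔ x ∈ invertibles C := by
  unfold yangLeeDim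
  split_ifs with hx <;> simp [hx, Real.one_lt_goldenRatio.ne']

theorem yangLeeDim_eq_goldenRatio_iff :
    yangLeeDim x = Real.goldenRatio ↔ x ∉ invertibles C := by
  unfold yangLeeDim
  split_ifs with hx <;> simp [hx, Real.one_lt_goldenRatio.ne]

variable (x) in
theorem yangLeeDim_pos : 0 < yangLeeDim x := by
  unfold yangLeeDim
  split_ifs
  exacts [one_pos, Real.goldenRatio_pos]

end

namespace Grading.IsYangLeeExtension

variable (k : Type*) [Field k] [IsAlgClosed k] {C : Type*} [Category* C] [Abelian C] [Linear k C]
  [MonoidalCategory C] [MonoidalPreadditive C] [MonoidalLinear k C] [RigidCategory C]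
  [IsFusionCategory k C] {G : Type*} [Group G] {𝒢 : Grading C G} {T : C}
  (hT : 𝒢.IsYangLeeExtension T)

include hT

theorem objDim_of_simple_tensor {S : C} [Simple S] (hTS : Simple (T ⊗ S)) :
    objDim k yangLeeDim S = 1 := by
  rwa [objDim_simple, yangLeeDim_eq_one_iff, hT.mk_mem_invertibles_iff k]

theorem objDim_of_not_simple_tensor {S : C} [Simple S] (hTS : ¬ Simple (T ⊗ S)) :
    objDim k yangLeeDim S = Real.goldenRatio := by
  rwa [objDim_simple, yangLeeDim_eq_goldenRatio_iff, hT.mk_mem_invertibles_iff k]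

theorem objDim_tensor (Z : C) :
    objDim k yangLeeDim (T ⊗ Z) = Real.goldenRatio * objDim k yangLeeDim Z := by
  refine objDim_tensor_eq_mul k _ (fun S hS => ?_) Z
  by_cases hTS : Simple (T ⊗ S)
  · rw [hT.objDim_of_simple_tensor k hTS, mul_one,
      hT.objDim_of_not_simple_tensor k (hT.not_simple_tensor_tensor k)]
  · obtain ⟨R, hR, hTR, ⟨e⟩⟩ := hT.exists_iso_tensor k hTS
    obtain ⟨f⟩ := hT.nonempty_tensor_tensor_iso R
    rw [objDim_congr k _ (whiskerLeftIso T e ≪≫ f), objDim_biprod, ← objDim_congr k _ e,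
      hT.objDim_of_simple_tensor k hTR, hT.objDim_of_not_simple_tensor k hTS, ← sq,
      Real.goldenRatio_sq, add_comm]

theorem objDim_invertible_tensor {D : C} (hD : IsInvertible D) (Z : C) :
    objDim k yangLeeDim (D ⊗ Z) = objDim k yangLeeDim Z := by
  rw [← one_mul (objDim k yangLeeDim Z)]
  refine objDim_tensor_eq_mul k _ (fun S hS => ?_) Z
  have := (hD.simple_tensor_iff k).2 hS
  obtain ⟨e⟩ := hT.nonempty_tensor_iso_comm k hD
  have hiff : Simple (T ⊗ (D ⊗ S)) ↔ Simple (T ⊗ S) :=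
    (Simple.iff_of_iso ((α_ T D S).symm ≪≫ whiskerRightIso e S ≪≫ α_ D T S)).trans
      (hD.simple_tensor_iff k)
  rw [one_mul]
  by_cases hTS : Simple (T ⊗ S)
  · rw [hT.objDim_of_simple_tensor k hTS, hT.objDim_of_simple_tensor k (hiff.2 hTS)]
  · rw [hT.objDim_of_not_simple_tensor k hTS, hT.objDim_of_not_simple_tensor k (hiff.not.2 hTS)]

theorem objDim_obj_tensor (x : Irr C) (Z : C) :
    objDim k yangLeeDim (x.obj ⊗ Z) = yangLeeDim x * objDim k yangLeeDim Z := by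
  by_cases hx : x ∈ invertibles C
  · rw [hT.objDim_invertible_tensor k hx, yangLeeDim_eq_one_iff.2 hx, one_mul]
  · obtain ⟨R, hR, hTR, ⟨e⟩⟩ := hT.exists_iso_tensor k ((hT.isInvertible_iff k).not.1 hx)
    rw [objDim_congr k _ (whiskerRightIso e Z ≪≫ α_ T R Z), hT.objDim_tensor k,
      hT.objDim_invertible_tensor k ((hT.isInvertible_iff k).2 hTR),
      yangLeeDim_eq_goldenRatio_iff.2 hx]

theorem FPdim_eq_yangLeeDim (x : Irr C) : FPdim k x = yangLeeDim x :=
  FPdim_eq_of_objDim_tensor k yangLeeDim_pos fun y => by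
    rw [hT.objDim_obj_tensor k, objDim_obj]

theorem FPdim_eq_one_iff {x : Irr C} : FPdim k x = 1 ↔ x ∈ invertibles C := by
  rw [hT.FPdim_eq_yangLeeDim k, yangLeeDim_eq_one_iff]

theorem FPdim_eq_goldenRatio_iff {x : Irr C} :
    FPdim k x = Real.goldenRatio ↔ x ∉ invertibles C := by
  rw [hT.FPdim_eq_yangLeeDim k, yangLeeDim_eq_goldenRatio_iff]

end Grading.IsYangLeeExtension

end YangLeeDim

section Counting

theorem Grading.natCard_eq {C : Type*} [Category* C] [Abelian C] [MonoidalCategory C]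
    {G : Type*} [Group G] (𝒢 : Grading C G) {p : Irr C → Prop}
    (hp : ∀ g, ∃! x, x ∈ 𝒢.irr g ∧ p x) : Nat.card {x // p x} = Nat.card G := by
  refine Nat.card_congr (.ofBijective (fun x => 𝒢.degree x.1) ⟨fun x y hxy => ?_, fun g => ?_⟩)
  · exact Subtype.ext ((hp (𝒢.degree y.1)).unique ⟨𝒢.mem_irr_iff.2 hxy, x.2⟩
      ⟨𝒢.component_degree y.1, y.2⟩)
  · obtain ⟨x, ⟨hx, hpx⟩, -⟩ := hp g
    exact ⟨⟨x, hpx⟩, 𝒢.mem_irr_iff.1 hx⟩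

namespace Grading.IsYangLeeExtension

variable (k : Type*) [Field k] [IsAlgClosed k] {C : Type*} [Category* C] [Abelian C] [Linear k C]
  [MonoidalCategory C] [MonoidalPreadditive C] [MonoidalLinear k C] [RigidCategory C]
  [IsFusionCategory k C] {G : Type*} [Group G] {𝒢 : Grading C G} {T : C}
  (hT : 𝒢.IsYangLeeExtension T) (h𝒢 : 𝒢.IsFaithful)

include k hT h𝒢

theorem natCard_invertibles : Nat.card (invertibles C) = Nat.card G :=
  𝒢.natCard_eq fun g => by
    obtain ⟨δ, y, hirr, hδ, hy⟩ := hT.exists_irr_eq_pair k h𝒢 g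
    refine ⟨δ, ⟨hirr ▸ .inl rfl, hδ⟩, fun x ⟨hx, hinv⟩ => ?_⟩
    obtain rfl | rfl := hirr ▸ hx
    exacts [rfl, absurd hinv hy]

theorem natCard_not_invertibles : Nat.card {x // x ∉ invertibles C} = Nat.card G :=
  𝒢.natCard_eq fun g => by
    obtain ⟨δ, y, hirr, hδ, hy⟩ := hT.exists_irr_eq_pair k h𝒢 g
    refine ⟨y, ⟨hirr ▸ .inr rfl, hy⟩, fun x ⟨hx, hinv⟩ => ?_⟩
    obtain rfl | rfl := hirr ▸ hx
    exacts [absurd hδ hinv, rfl]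

theorem isOfType : IsOfType k C ![1, Real.goldenRatio]
    ![Nat.card (invertibles C), Nat.card (invertibles C)] where
  dim_zero := rfl
  dim_strictMono := by simp [Fin.strictMono_iff_lt_succ, Real.one_lt_goldenRatio]
  mult_pos := by
    have := finite_irr k C
    obtain ⟨δ, -, -, hδ, -⟩ := hT.exists_irr_eq_pair k h𝒢 1
    have : Nonempty (invertibles C) := ⟨⟨δ, hδ⟩⟩
    exact Fin.forall_fin_two.2 ⟨Nat.card_pos, Nat.card_pos⟩
  card_eq := Fin.forall_fin_two.2
    ⟨Nat.card_congr (.subtypeEquivRight fun _ => hT.FPdim_eq_one_iff k),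
      (Nat.card_congr (.subtypeEquivRight fun _ => hT.FPdim_eq_goldenRatio_iff k)).trans
        ((hT.natCard_not_invertibles k h𝒢).trans (hT.natCard_invertibles k h𝒢).symm)⟩
  exhaust x := by
    by_cases hx : x ∈ invertibles C
    · exact ⟨0, (hT.FPdim_eq_one_iff k).2 hx⟩
    · exact ⟨1, (hT.FPdim_eq_goldenRatio_iff k).2 hx⟩

theorem fromUniversal_bijective : Function.Bijective 𝒢.fromUniversal := by
  refine ⟨𝒢.fromUniversal_injective k fun _ => hT.universalDegree_eq_one, fun g => ?_⟩
  obtain ⟨δ, y, hirr, -⟩ := hT.exists_irr_eq_pair k h𝒢 g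
  refine ⟨universalDegree δ, ?_⟩
  rw [𝒢.fromUniversal_universalDegree, ← 𝒢.mem_irr_iff, hirr]
  exact .inl rfl

end Grading.IsYangLeeExtension

theorem IsYangLee.exists_isYangLeeExtension {k : Type*} [Field k] [IsAlgClosed k]
    {C : Type*} [Category* C] [Abelian C] [Linear k C] [MonoidalCategory C]
    [MonoidalPreadditive C] [MonoidalLinear k C] [RigidCategory C] [IsFusionCategory k C]
    {Y : Type*} [Category* Y] [Abelian Y] [Linear k Y] [MonoidalCategory Y]
    [MonoidalPreadditive Y] [MonoidalLinear k Y] [RigidCategory Y] (hY : IsYangLee k Y)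
    {G : Type*} [Group G] {𝒢 : Grading C G}
    (ι : Y ⥤ C) [ι.Monoidal] [ι.Additive] [ι.Linear k] [ι.Full] [ι.Faithful]
    (hι : ι.essImage = 𝒢.component 1) : ∃ T : C, 𝒢.IsYangLeeExtension T := by
  obtain ⟨_, X, hX, -, hirr, hXX⟩ := hY
  have simple_map_iff (S : Y) : Simple (ι.obj S) ↔ Simple S := by
    rw [simple_iff_homDim_self k, homDim_map k ι, simple_iff_homDim_self k]
  refine ⟨ι.obj X, (IsFibonacci.mk hX hXX).map ι ((simple_map_iff X).2 hX), fun S hS hS1 => ?_⟩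
  rw [← hι] at hS1
  obtain ⟨S', ⟨e⟩⟩ := hS1
  obtain ⟨⟨f⟩⟩ | ⟨⟨f⟩⟩ := hirr S' ((simple_map_iff S').1 (Simple.of_iso e))
  · exact .inl ⟨e.symm ≪≫ ι.mapIso f ≪≫ (Functor.Monoidal.εIso ι).symm⟩
  · exact .inr ⟨e.symm ≪≫ ι.mapIso f⟩

end Counting

end Fusion

theorem mainTheorem3_general {k : Type*} [Field k] [IsAlgClosed k]
    {C : Type*} [Category* C] [Abelian C] [Linear k C] [MonoidalCategory C]
    [MonoidalPreadditive C] [MonoidalLinear k C] [RigidCategory C]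
    [Fusion.IsFusionCategory k C]
    {Y : Type*} [Category* Y] [Abelian Y] [Linear k Y] [MonoidalCategory Y]
    [MonoidalPreadditive Y] [MonoidalLinear k Y] [RigidCategory Y]
    (hY : Fusion.IsYangLee k Y)
    {G : Type*} [Group G] (𝒢 : Fusion.Grading C G) (h𝒢 : 𝒢.IsFaithful)
    (ι : Y ⥤ C) [ι.Monoidal] [ι.Additive] [ι.Linear k] [ι.Full] [ι.Faithful]
    (hι : ι.essImage = 𝒢.component 1) :
    Fusion.IsOfType k C ![1, (1 + √5) / 2]
      ![Nat.card (Fusion.invertibles C), Nat.card (Fusion.invertibles C)] ∧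
    (∀ g : G, (𝒢.irr g).ncard = 2 ∧ ∃ δ Yg : Fusion.Irr C, 𝒢.irr g = {δ, Yg} ∧
      δ ∈ Fusion.invertibles C ∧ Fusion.FPdim k δ = 1 ∧ Fusion.FPdim k Yg = (1 + √5) / 2) ∧
    ι.essImage = Fusion.adjointSubcategory C ∧
    (∃ φ : Fusion.UniversalGradingGroup C ≃* G, ∀ (g : G) (x : Fusion.Irr C),
      x ∈ 𝒢.irr g ↔ φ (Fusion.universalDegree x) = g) ∧
    Nat.card (Fusion.UniversalGradingGroup C) = Nat.card (Fusion.invertibles C) := by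
  obtain ⟨T, hT⟩ := hY.exists_isYangLeeExtension ι hι
  refine ⟨hT.isOfType k h𝒢, fun g => ?_, hι.trans (hT.component_one_eq_adjointSubcategory k),
    ⟨MulEquiv.ofBijective _ (hT.fromUniversal_bijective k h𝒢), fun g x => ?_⟩, ?_⟩
  · obtain ⟨δ, y, hirr, hδ, hy⟩ := hT.exists_irr_eq_pair k h𝒢 g
    refine ⟨?_, δ, y, hirr, hδ, (hT.FPdim_eq_one_iff k).2 hδ,
      (hT.FPdim_eq_goldenRatio_iff k).2 hy⟩
    rw [hirr, Set.ncard_pair (ne_of_mem_of_not_mem hδ hy)]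
  · rw [MulEquiv.ofBijective_apply, 𝒢.fromUniversal_universalDegree, 𝒢.mem_irr_iff]
  · rw [hT.natCard_invertibles k h𝒢]
    exact Nat.card_congr (.ofBijective _ (hT.fromUniversal_bijective k h𝒢))

theorem mainTheorem3 {k : Type*} [Field k] [IsAlgClosed k] [CharZero k]
    {C : Type*} [Category* C] [Abelian C] [Linear k C] [MonoidalCategory C]
    [MonoidalPreadditive C] [MonoidalLinear k C] [RigidCategory C]
    [Fusion.IsFusionCategory k C]
    {Y : Type*} [Category* Y] [Abelian Y] [Linear k Y] [MonoidalCategory Y]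
    [MonoidalPreadditive Y] [MonoidalLinear k Y] [RigidCategory Y]
    (hY : Fusion.IsYangLee k Y)
    {G : Type*} [Group G] (𝒢 : Fusion.Grading C G) (h𝒢 : 𝒢.IsFaithful)
    -- the identification of `Y` with the trivial component of the grading
    (ι : Y ⥤ C) [ι.Monoidal] [ι.Additive] [ι.Linear k] [ι.Full] [ι.Faithful]
    (hι : ι.essImage = 𝒢.component 1) :
    Fusion.IsOfType k C ![1, (1 + √5) / 2]
      ![Nat.card (Fusion.invertibles C), Nat.card (Fusion.invertibles C)] ∧
    (∀ g : G, (𝒢.irr g).ncard = 2 ∧ ∃ δ Yg : Fusion.Irr C, 𝒢.irr g = {δ, Yg} ∧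
      δ ∈ Fusion.invertibles C ∧ Fusion.FPdim k δ = 1 ∧ Fusion.FPdim k Yg = (1 + √5) / 2) ∧
    ι.essImage = Fusion.adjointSubcategory C ∧
    (∃ φ : Fusion.UniversalGradingGroup C ≃* G, ∀ (g : G) (x : Fusion.Irr C),
      x ∈ 𝒢.irr g ↔ φ (Fusion.universalDegree x) = g) ∧
    Nat.card (Fusion.UniversalGradingGroup C) = Nat.card (Fusion.invertibles C) :=
  mainTheorem3_general hY 𝒢 h𝒢 ι hι
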